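/- All digraphs are finite and acyclic (dags). A \emph{$t$-track assignment} of a dag $G$ is a proper vertex colouring of the underlying undirected graph with $t$ colours (some colour classes may be empty), together with a total order $<_i$ on each colour class $V_i$ (a \emph{track}). An \emph{X-crossing} consists of two edges $vw$ and $xy$ with $v<_i x$ and $y<_j w$ for distinct $i,j$. An \emph{upward $t$-track layout} of $G$ is a $t$-track assignment with no X-crossing such that the directed graph $G^+$, obtained from $G$ by adding an arc from each vertex to its successor (if any) in its track, is acyclic. An \emph{upward $(k,t)$-track layout} is defined in the same way, except that each edge is assigned one of $k$ colours and only monochromatic X-crossings are forbidden. Let $\mathrm{utn}(G)$ be the minimum $t$ such that $G$ has an upward $t$-track layout, and $\mathrm{utn}_k(G)$ the minimum $t$ such that $G$ has an upward $(k,t)$-track layout. An \emph{upward $k$-queue layout} of $G$ ($k\ge 0$) is a topological vertex ordering $\sigma$ together with an assignment of the edges to $k$ classes (some possibly empty) such that no two edges $vw,xy$ in the same class satisfy $\sigma(v)<\sigma(x)<\sigma(y)<\sigma(w)$. Let $\mathrm{uqn}(G)$ be the minimum $k$ such that $G$ has an upward $k$-queue layout. Theorem. Upward track-number and upward queue-number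 are tied: there is a function $f:\mathbb{N}\to\mathbb{N}$ such that $\mathrm{utn}(G)\le f(\mathrm{uqn}(G))$ and $\mathrm{uqn}(G)\le f(\mathrm{utn}(G))$ for every dag $G$. Specifically, for every dag $G$: (1) for every integer $k\ge 1$, $\mathrm{uqn}(G)\le k\binom{\mathrm{utn}_k(G)}{2}$; (2) for every integer $q\ge 1$, if $\mathrm{uqn}(G)\le q$, then $\mathrm{utn}(G)\le 4q\cdot 4^{q(2q-1)(4q-1)}$. -/

import Mathlib

universe u

namespace SimpleGraph

variable {V : Type u}

/-- A `t`-track assignment of a graph: a proper vertex `t`-colouring together with a strict total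
order on each colour class. The relation `lt v w` says that `v` and `w` lie in the same colour
class and `v` precedes `w` there. -/
structure TrackAssignment (G : SimpleGraph V) (t : ℕ) where
  track : G.Coloring (Fin t)
  lt : V → V → Prop
  lt_same : ∀ v w, lt v w → track v = track w
  lt_irrefl : ∀ v, ¬ lt v v
  lt_trans : ∀ u v w, lt u v → lt v w → lt u w
  lt_total : ∀ v w, track v = track w → v ≠ w → lt v w ∨ lt w v

namespace TrackAssignment

variable {G : SimpleGraph V} {t : ℕ}

/-- The pairs `vw` and `xy` (edges, where this is used) form an X-crossing: `v` precedes `x` in one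
track, and `y` precedes `w` in another track. -/
def XCross (T : G.TrackAssignment t) (v w x y : V) : Prop :=
  T.track v ≠ T.track w ∧ T.lt v x ∧ T.lt y w

/-- A track layout is a track assignment with no X-crossing. -/
def IsTrackLayout (T : G.TrackAssignment t) : Prop :=
  ∀ v w x y, G.Adj v w → G.Adj x y → ¬ T.XCross v w x y

/-- A `(k, t)`-track layout: each edge gets one of `k` colours so that there is no
monochromatic X-crossing. -/
def IsColouredTrackLayout (T : G.TrackAssignment t) (k : ℕ) : Prop :=
  ∃ c : G.edgeSet → Fin k, ∀ (v w x y : V) (e : G.Adj v w) (f : G.Adj x y),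
    c ⟨s(v, w), e⟩ = c ⟨s(x, y), f⟩ → ¬ T.XCross v w x y

/-- `w` is the successor of `v` in the track that contains `v`. -/
def Succ (T : G.TrackAssignment t) (v w : V) : Prop :=
  T.lt v w ∧ ∀ x, ¬ (T.lt v x ∧ T.lt x w)

end TrackAssignment

/-- The vertex ordering `σ` and the partition `E` of the edges into `k` classes form a `k`-queue
layout: no two edges of one class are nested. -/
def IsQueueLayout (G : SimpleGraph V) {k : ℕ} (σ : V ≃ Fin (Nat.card V))
    (E : G.edgeSet → Fin k) : Prop :=
  ∀ (v w x y : V) (e : G.Adj v w) (f : G.Adj x y), E ⟨s(v, w), e⟩ = E ⟨s(x, y), f⟩ →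
    ¬ (σ v < σ x ∧ σ x < σ y ∧ σ y < σ w)

end SimpleGraph

namespace Digraph

variable {V : Type u}

/-- A directed graph is acyclic if it has no directed cycle (loops and 2-cycles included). -/
def IsAcyclic (D : Digraph V) : Prop :=
  ∀ v, ¬ Relation.TransGen D.Adj v v

/-- The directed graph `G⁺`: add to `D` an arc from each vertex to its successor in its track. -/
def plus (D : Digraph V) {t : ℕ} (T : D.toSimpleGraphInclusive.TrackAssignment t) : Digraph V where
  Adj v w := D.Adj v w ∨ T.Succ v w

/-- `D` has an upward `t`-track layout. -/
def HasUpwardTrackLayout (D : Digraph V) (t : ℕ) : Prop :=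
  ∃ T : D.toSimpleGraphInclusive.TrackAssignment t, T.IsTrackLayout ∧ (D.plus T).IsAcyclic

/-- `D` has an upward `(k, t)`-track layout. -/
def HasUpwardColouredTrackLayout (D : Digraph V) (k t : ℕ) : Prop :=
  ∃ T : D.toSimpleGraphInclusive.TrackAssignment t,
    T.IsColouredTrackLayout k ∧ (D.plus T).IsAcyclic

/-- A vertex ordering is topological if every arc goes forward. -/
def IsTopological (D : Digraph V) (σ : V ≃ Fin (Nat.card V)) : Prop :=
  ∀ v w, D.Adj v w → σ v < σ w

/-- `D` has an upward `k`-queue layout. -/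
def HasUpwardQueueLayout (D : Digraph V) (k : ℕ) : Prop :=
  ∃ (σ : V ≃ Fin (Nat.card V)) (E : D.toSimpleGraphInclusive.edgeSet → Fin k),
    D.IsTopological σ ∧ D.toSimpleGraphInclusive.IsQueueLayout σ E

/-- Upward track-number. -/
noncomputable def upwardTrackNumber (D : Digraph V) : ℕ :=
  sInf {t | D.HasUpwardTrackLayout t}

/-- The minimum `t` such that `D` has an upward `(k, t)`-track layout. -/
noncomputable def upwardColouredTrackNumber (D : Digraph V) (k : ℕ) : ℕ :=
  sInf {t | D.HasUpwardColouredTrackLayout k t}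

/-- Upward queue-number. -/
noncomputable def upwardQueueNumber (D : Digraph V) : ℕ :=
  sInf {k | D.HasUpwardQueueLayout k}

/-! For a finite acyclic digraph the three minima above are over nonempty sets. -/

theorem exists_upwardTrackLayout [Finite V] (D : Digraph V) (hD : D.IsAcyclic) :
    ∃ t, D.HasUpwardTrackLayout t := by
  let e := Finite.equivFin V
  refine ⟨Nat.card V, ⟨SimpleGraph.Coloring.mk e fun h h' => h.ne (e.injective h'),
    fun _ _ => False, by simp, by simp, by simp, ?_⟩, ?_, ?_⟩
  · intro v w h hne
    exact absurd (e.injective h) hne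
  · rintro v w x y - - ⟨-, h, -⟩
    exact h
  · intro v h
    refine hD v (Relation.TransGen.mono (fun a b hab => ?_) _ _ h)
    rcases hab with hab | hab
    · exact hab
    · exact hab.1.elim

theorem HasUpwardTrackLayout.coloured {D : Digraph V} {t k : ℕ} (h : D.HasUpwardTrackLayout t)
    (hk : 1 ≤ k) : D.HasUpwardColouredTrackLayout k t := by
  obtain ⟨T, hT, hT'⟩ := h
  exact ⟨T, ⟨fun _ => ⟨0, hk⟩, fun v w x y e f _ => hT v w x y e f⟩, hT'⟩

theorem exists_topological [Finite V] (D : Digraph V) (hD : D.IsAcyclic) :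
    ∃ σ : V ≃ Fin (Nat.card V), D.IsTopological σ := by
  classical
  have : Fintype V := Fintype.ofFinite V
  have : IsPartialOrder V (Relation.ReflTransGen D.Adj) :=
    { refl := fun _ => Relation.ReflTransGen.refl
      trans := fun _ _ _ => Relation.ReflTransGen.trans
      antisymm := by
        intro a b h h'
        rcases Relation.reflTransGen_iff_eq_or_transGen.1 h with h | h
        · exact h.symm
        · exact absurd (h.trans_left h') (hD a) }
  obtain ⟨s, hs, hle⟩ := extend_partialOrder (Relation.ReflTransGen D.Adj)
  let _ : LinearOrder V :=
    { le := s
      le_refl := hs.refl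
      le_trans := hs.trans
      le_antisymm := hs.antisymm
      le_total := hs.total
      toDecidableLE := Classical.decRel _ }
  let σ := (Fintype.orderIsoFinOfCardEq V (Nat.card_eq_fintype_card (α := V)).symm).symm
  refine ⟨σ.toEquiv, fun v w h => σ.lt_iff_lt.2 (lt_of_le_of_ne ?_ ?_)⟩
  · exact hle _ _ (Relation.ReflTransGen.single h)
  · rintro rfl
    exact hD v (Relation.TransGen.single h)

theorem exists_upwardQueueLayout [Finite V] (D : Digraph V) (hD : D.IsAcyclic) :
    ∃ k, D.HasUpwardQueueLayout k := by
  obtain ⟨σ, hσ⟩ := D.exists_topological hD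
  refine ⟨Nat.card D.toSimpleGraphInclusive.edgeSet, σ, Finite.equivFin _, hσ, ?_⟩
  rintro v w x y e f h ⟨h1, h2, h3⟩
  have := congrArg Subtype.val ((Finite.equivFin _).injective h)
  rcases Sym2.eq_iff.1 this with ⟨rfl, rfl⟩ | ⟨rfl, rfl⟩
  · exact lt_irrefl _ h1
  · exact lt_irrefl _ (h1.trans h2)

end Digraph

/-! ### Four labels that separate two noncrossing relations -/

section Separation

/-! From tracks to queues: order the vertices topologically in G⁺, which makes every track
increasing. Nested edges with the same colour and the same pair of tracks then form an X-crossing,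
so the classes can be indexed by a colour and a pair of tracks.

From queues to tracks: a q-queue graph is 4q-colourable, and ordering the colour classes by the
queue order makes the layout upward automatically. X-crossings are removed by splitting classes.
Between two classes, edges with the same queue and the same direction never cross, which leaves 2q
noncrossing relations; for each pair of them the crossings are destroyed by four labels on each side
(`exists_labels_of_noncrossing`). A vertex carries one label for every other class and every pair of
relations, hence the bound. -/

/-- A relation between linear orders is noncrossing if it is weakly monotone. -/
def Noncrossing {A : Type*} [LinearOrder A] (U : A → A → Prop) : Prop :=
  ∀ a b c d, U a b → U c d → a < c → b ≤ d

/-- A relation contained in the strict order of a finite linear order has a height function. -/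
theorem exists_height {A : Type*} [LinearOrder A] [Finite A] (r : A → A → Prop)
    (hr : ∀ a b, r a b → a < b) :
    ∃ h : A → ℕ, (∀ a b, r a b → h a + 1 ≤ h b) ∧
      ∀ b, h b = 0 ∨ ∃ a, r a b ∧ h b = h a + 1 := by
  classical
  have : Fintype A := Fintype.ofFinite A
  let F : (b : A) → ((a : A) → a < b → ℕ) → ℕ := fun b ih =>
    Finset.univ.sup fun a => if h : r a b then ih a (hr a b h) + 1 else 0
  let h : A → ℕ := (wellFounded_lt (α := A)).fix F
  have hh : ∀ b, h b = Finset.univ.sup fun a => if r a b then h a + 1 else 0 := by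
    intro b
    have := (wellFounded_lt (α := A)).fix_eq F b
    simpa [F, h] using this
  refine ⟨h, fun a b hab => ?_, fun b => ?_⟩
  · rw [hh b]
    have := Finset.le_sup (f := fun a => if r a b then h a + 1 else 0) (Finset.mem_univ a)
    simpa [hab] using this
  · obtain ⟨a, -, ha⟩ := Finset.exists_mem_eq_sup Finset.univ ⟨b, Finset.mem_univ b⟩
      (fun a => if r a b then h a + 1 else 0)
    rw [← hh b] at ha
    by_cases hab : r a b
    · exact Or.inr ⟨a, hab, by simpa [hab] using ha⟩
    · exact Or.inl (by simpa [hab] using ha)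

theorem exists_sup_succ {A : Type*} [Finite A] (P : A → Prop) (f : A → ℕ) :
    ∃ m, (∀ a, P a → f a + 1 ≤ m) ∧ (m = 0 ∨ ∃ a, P a ∧ m = f a + 1) := by
  classical
  have : Fintype A := Fintype.ofFinite A
  refine ⟨Finset.univ.sup fun a => if P a then f a + 1 else 0, fun a ha => ?_, ?_⟩
  · have := Finset.le_sup (f := fun a => if P a then f a + 1 else 0) (Finset.mem_univ a)
    simpa [ha] using this
  · rcases isEmpty_or_nonempty A with hA | hA
    · left; simp
    obtain ⟨a, -, ha⟩ := Finset.exists_mem_eq_sup Finset.univ Finset.univ_nonempty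
      (fun a => if P a then f a + 1 else 0)
    by_cases hP : P a
    · exact Or.inr ⟨a, hP, by simpa [hP] using ha⟩
    · exact Or.inl (by simpa [hP] using ha)

/-- Two noncrossing relations `U` and `D`, in which every pair of `U` crosses a pair of `D` below
it and every pair of `D` crosses a pair of `U` above it, are separated by four labels. -/
theorem exists_labels_of_noncrossing {A : Type*} [LinearOrder A] [Finite A] (U D : A → A → Prop)
    (hU : Noncrossing U) (hD : Noncrossing D)
    (hUD : ∀ a b, U a b → ∃ c d, D c d ∧ a < c ∧ d < b)
    (hDU : ∀ c d, D c d → ∃ a b, U a b ∧ a < c ∧ d < b) :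
    ∃ α β : A → Fin 4, ∀ a b c d, U a b → D c d → a < c → d < b → α a = α c → β b ≠ β d := by
  -- One step from `a` to `c`: along `U`, weakly right, back along `D`, weakly right. The pair of
  -- `D` crossing below the `U`-pair forces `a < c`. So `h c` is the length of a longest chain of
  -- steps ending at `c`; `m` below is the corresponding height on the other side.
  obtain ⟨h, h1, h2⟩ := exists_height
    (fun a c => ∃ b b' c', U a b ∧ b ≤ b' ∧ D c' b' ∧ c' ≤ c) (by
      rintro a c ⟨b, b', c', hab, hbb, hcb, hcc⟩
      obtain ⟨p, r, hpr, hap, hrb⟩ := hUD a b hab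
      by_contra! hca
      exact absurd (hD _ _ _ _ hcb hpr ((hcc.trans hca).trans_lt hap)) (by order))
  have hmono : ∀ a c, a ≤ c → h a ≤ h c := by
    intro a c hac
    rcases h2 a with h0 | ⟨e, ⟨b, b', c', hab, hbb, hcb, hcc⟩, he⟩
    · omega
    · rw [he]
      exact h1 e c ⟨b, b', c', hab, hbb, hcb, hcc.trans hac⟩
  choose m m1 m2 using fun b => exists_sup_succ (fun a => ∃ b₀, U a b₀ ∧ b₀ ≤ b) h
  have mmono : ∀ b d, b ≤ d → m b ≤ m d := by
    intro b d hbd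
    rcases m2 b with h0 | ⟨a, ⟨b₀, hab, hb⟩, he⟩
    · omega
    · rw [he]
      exact m1 d a ⟨b₀, hab, hb.trans hbd⟩
  have hU1 : ∀ a b, U a b → h a + 1 ≤ m b := fun a b hab => m1 b a ⟨b, hab, le_rfl⟩
  have hD1 : ∀ c d, D c d → m d ≤ h c := by
    intro c d hcd
    rcases m2 d with h0 | ⟨a, ⟨b₀, hab, hb⟩, he⟩
    · omega
    · rw [he]
      exact h1 a c ⟨b₀, d, c, hab, hb, hcd, le_rfl⟩
  have hU2 : ∀ a b, U a b → m b ≤ h a + 2 := by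
    intro a b hab
    rcases m2 b with h0 | ⟨a₀, ⟨b₀, hab₀, hb⟩, he⟩
    · omega
    rcases le_or_gt a₀ a with ha | ha
    · have := hmono _ _ ha
      omega
    have hb' := hU _ _ _ _ hab hab₀ ha
    -- Unwind one step from `a₀` to `a₁`: the pair of `D` crossing below `U a₀ b₀` puts `b₁` before
    -- `b`, hence `a₁ ≤ a`.
    rcases h2 a₀ with h0 | ⟨a₁, ⟨b₁, b', c, hab₁, hbb, hcb, hca⟩, he'⟩
    · omega
    obtain ⟨p, r, hpr, hap, hrb⟩ := hUD a₀ b₀ hab₀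
    have hb'r := hD _ _ _ _ hcb hpr (hca.trans_lt hap)
    have : a₁ ≤ a := by
      by_contra! hlt
      exact absurd (hU _ _ _ _ hab hab₁ hlt) (by order)
    have := hmono _ _ this
    omega
  have hD2 : ∀ c d, D c d → h c ≤ m d + 1 := by
    intro c d hcd
    rcases h2 c with h0 | ⟨a₀, ⟨b₀, b₁, c₁, hab₀, hbb, hcb, hcc⟩, he⟩
    · omega
    rcases hcc.lt_or_eq with hlt | rfl
    · have := m1 d a₀ ⟨b₀, hab₀, hbb.trans (hD _ _ _ _ hcb hcd hlt)⟩
      omega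
    -- Here the last step lands exactly on `c`, so noncrossing of `D` says nothing about `b₁` and
    -- `d`. The pair of `U` crossing above puts `a₀` strictly before `c`, and the step before that
    -- one serves, at the cost of 1.
    obtain ⟨p, r, hpr, hpc, hbr⟩ := hDU _ _ hcb
    have ha₀ : a₀ ≤ p := by
      by_contra! hlt
      exact absurd (hU _ _ _ _ hpr hab₀ hlt) (by order)
    rcases h2 a₀ with h0 | ⟨a₁, ⟨b₂, b₃, c₂, hab₁, hbb', hcb', hca⟩, he'⟩
    · omega
    have := m1 d a₁ ⟨b₂, hab₁, hbb'.trans (hD _ _ _ _ hcb' hcd (by order))⟩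
    omega
  -- In a crossing, `h a ≤ h c ≤ h a + 3`, so equal residues give `h a = h c`. Then `m d ≤ h a < m b
  -- ≤ m d + 3`, so the other residues differ.
  refine ⟨fun a => ⟨h a % 4, Nat.mod_lt _ (by norm_num)⟩,
    fun b => ⟨m b % 4, Nat.mod_lt _ (by norm_num)⟩, ?_⟩
  intro a b c d hab hcd hac hdb hα hβ
  have e1 : h a % 4 = h c % 4 := congrArg Fin.val hα
  have e2 : m b % 4 = m d % 4 := congrArg Fin.val hβ
  have := hmono _ _ hac.le
  have := mmono _ _ hdb.le
  have := hU1 _ _ hab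
  have := hU2 _ _ hab
  have := hD1 _ _ hcd
  have := hD2 _ _ hcd
  omega

/-- Given noncrossing relations indexed by colours, the crossings between two colours are
separated by four labels. -/
theorem exists_labels_of_colours {A K : Type*} [LinearOrder A] [Finite A] (E : K → A → A → Prop)
    (hE : ∀ k, Noncrossing (E k)) (s : Sym2 K) :
    ∃ α β : A → Fin 4, ∀ k l a b c d, s(k, l) = s → E k a b → E l c d → a < c → d < b →
      α a = α c → β b ≠ β d := by
  have key : ∀ k l k' l', s(k, l) = s → s(k', l') = s → (k = k' ∧ l = l') ∨ (k = l' ∧ l = k') :=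
    fun k l k' l' h h' => by simpa using Sym2.eq_iff.1 (h.trans h'.symm)
  -- Take the upper and the lower members of crossings between the two colours. Two upper members of
  -- different colours are compared through the crossing partner of the right-hand one, which has
  -- the colour of the other; lower members are treated symmetrically.
  obtain ⟨α, β, h⟩ := exists_labels_of_noncrossing
    (fun a b => ∃ k l c d, s(k, l) = s ∧ E k a b ∧ E l c d ∧ a < c ∧ d < b)
    (fun c d => ∃ k l a b, s(k, l) = s ∧ E k a b ∧ E l c d ∧ a < c ∧ d < b)
    (by
      rintro a b c d ⟨k, l, a', b', hkl, e, f, ha, hb⟩ ⟨k', l', c', d', hkl', e', f', hc, hd⟩ hac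
      rcases key _ _ _ _ hkl hkl' with ⟨rfl, rfl⟩ | ⟨rfl, rfl⟩
      · exact hE k _ _ _ _ e e' hac
      · exact (hE k _ _ _ _ e f' (hac.trans hc)).trans hd.le)
    (by
      rintro a b c d ⟨k, l, a', b', hkl, e, f, ha, hb⟩ ⟨k', l', c', d', hkl', e', f', hc, hd⟩ hac
      rcases key _ _ _ _ hkl hkl' with ⟨rfl, rfl⟩ | ⟨rfl, rfl⟩
      · exact hE l _ _ _ _ f f' hac
      · exact hb.le.trans (hE k _ _ _ _ e f' (ha.trans hac)))
    (by
      rintro a b ⟨k, l, c, d, hkl, e, f, ha, hb⟩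
      exact ⟨c, d, ⟨k, l, a, b, hkl, e, f, ha, hb⟩, ha, hb⟩)
    (by
      rintro c d ⟨k, l, a, b, hkl, e, f, ha, hb⟩
      exact ⟨a, b, ⟨k, l, c, d, hkl, e, f, ha, hb⟩, ha, hb⟩)
  exact ⟨α, β, fun k l a b c d hkl e f hac hdb =>
    h a b c d ⟨k, l, c, d, hkl, e, f, hac, hdb⟩ ⟨k, l, a, b, hkl, e, f, hac, hdb⟩ hac hdb⟩

end Separation

/-! ### Degeneracy of queue graphs and greedy colouring -/

section Colouring

open Finset

/-- A linearly ordered vertex set whose edges have `q` colours without monochromatic nesting spans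
few edges, hence has a vertex of small degree. -/
theorem exists_degree_lt_of_queue {V : Type*} [LinearOrder V] (G : SimpleGraph V)
    [DecidableRel G.Adj] {q : ℕ} (hq : 1 ≤ q) (col : Sym2 V → Fin q)
    (hcol : ∀ v w x y, G.Adj v w → G.Adj x y → col s(v, w) = col s(x, y) →
      ¬ (v < x ∧ x < y ∧ y < w)) (W : Finset V) (hW : W.Nonempty) :
    ∃ v ∈ W, #{w ∈ W | G.Adj v w} < 4 * q := by
  by_contra! hdeg
  let r : V → ℕ := fun v => #{u ∈ W | u < v}
  have hr : ∀ v ∈ W, ∀ w, v < w → r v < r w := by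
    intro v hv w hvw
    refine Finset.card_lt_card ((Finset.ssubset_iff_of_subset ?_).2 ⟨v, ?_, ?_⟩)
    · intro u
      simp only [mem_filter]
      exact fun h => ⟨h.1, h.2.trans hvw⟩
    · simp [hv, hvw]
    · simp
  have hrW : ∀ v ∈ W, r v < #W := by
    intro v hv
    refine Finset.card_lt_card ((Finset.ssubset_iff_of_subset (filter_subset _ _)).2 ⟨v, hv, ?_⟩)
    simp
  let P : Finset (V × V) := {p ∈ W ×ˢ W | p.1 < p.2 ∧ G.Adj p.1 p.2}
  let N : Finset (V × V) := {p ∈ W ×ˢ W | G.Adj p.1 p.2}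
  have hP : #P ≤ q * (2 * #W - 1) := by
    have : #P ≤ #((Finset.univ : Finset (Fin q)) ×ˢ Finset.range (2 * #W - 1)) := by
      -- Distinct edges with the same sum of endpoint ranks are nested, so within one queue the sum
      -- determines the edge.
      refine Finset.card_le_card_of_injOn (fun p => (col s(p.1, p.2), r p.1 + r p.2)) ?_ ?_
      · rintro ⟨v, w⟩ hp
        simp only [P, coe_filter, mem_product, Set.mem_ofPred_eq] at hp
        have h1 := hrW v hp.1.1
        have h2 := hrW w hp.1.2
        simp only [coe_product, Set.mem_prod, mem_coe, mem_univ, mem_range, true_and]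
        omega
      · rintro ⟨v, w⟩ hp ⟨x, y⟩ hp' heq
        simp only [P, coe_filter, mem_product, Set.mem_ofPred_eq] at hp hp'
        simp only [Prod.mk.injEq] at heq
        obtain ⟨⟨hv, hw⟩, hvw, e⟩ := hp
        obtain ⟨⟨hx, hy⟩, hxy, f⟩ := hp'
        have hrw : ∀ {a b : V}, a ∈ W → b ∈ W → r a < r b → a < b := by
          intro a b ha hb h
          by_contra! hba
          rcases hba.lt_or_eq with hlt | rfl
          · exact absurd (hr b hb a hlt) (by omega)
          · omega
        rcases lt_trichotomy v x with h | rfl | h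
        · have := hr v hv x h
          exact absurd ⟨h, hxy, hrw hy hw (by omega)⟩ (hcol v w x y e f heq.1)
        · rcases lt_trichotomy w y with h | rfl | h
          · have := hr w hw y h
            omega
          · rfl
          · have := hr y hy w h
            omega
        · have := hr x hx v h
          exact absurd ⟨h, hvw, hrw hw hy (by omega)⟩ (hcol x y v w f e heq.1.symm)
    simpa using this
  have hN : #N ≤ #P + #P := by
    have hsub : N ⊆ P ∪ P.map (Equiv.prodComm V V).toEmbedding := by
      rintro ⟨v, w⟩ hp
      simp only [N, mem_filter, mem_product] at hp
      simp only [P, mem_union, mem_filter, mem_product, mem_map_equiv, Equiv.prodComm_symm,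
        Equiv.prodComm_apply, Prod.swap_prod_mk]
      rcases lt_or_gt_of_ne hp.2.ne with h | h
      · exact Or.inl ⟨hp.1, h, hp.2⟩
      · exact Or.inr ⟨hp.1.symm, h, hp.2.symm⟩
    calc #N ≤ _ := card_le_card hsub
      _ ≤ _ := card_union_le _ _
      _ = _ := by rw [card_map]
  have hN' : #N = ∑ v ∈ W, #{w ∈ W | G.Adj v w} := by
    simp only [N, card_filter, sum_product]
  have hsum : #W * (4 * q) ≤ ∑ v ∈ W, #{w ∈ W | G.Adj v w} := by
    simpa using Finset.card_nsmul_le_sum W _ (4 * q) hdeg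
  have hpos := hW.card_pos
  obtain ⟨n, hn⟩ : ∃ n, #W = n + 1 := ⟨#W - 1, by omega⟩
  rw [hn] at hP hsum
  have h1 : 2 * (n + 1) - 1 = 2 * n + 1 := by omega
  rw [h1] at hP
  nlinarith

/-- Graphs in which every nonempty finite vertex set has a vertex of degree less than `k` within
the set are `k`-colourable. -/
theorem colorable_of_exists_degree_lt {V : Type*} [Finite V] (G : SimpleGraph V)
    [DecidableRel G.Adj] {k : ℕ} (hk : 1 ≤ k)
    (h : ∀ W : Finset V, W.Nonempty → ∃ v ∈ W, #{w ∈ W | G.Adj v w} < k) : G.Colorable k := by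
  classical
  have : Fintype V := Fintype.ofFinite V
  have main : ∀ W : Finset V, ∃ c : V → Fin k, ∀ v ∈ W, ∀ w ∈ W, G.Adj v w → c v ≠ c w := by
    intro W
    induction W using Finset.strongInduction with
    | H W ih =>
      rcases W.eq_empty_or_nonempty with rfl | hW
      · exact ⟨fun _ => ⟨0, hk⟩, by simp⟩
      obtain ⟨v, hv, hdeg⟩ := h W hW
      obtain ⟨c, hc⟩ := ih (W.erase v) (erase_ssubset hv)
      obtain ⟨i, hi⟩ : ∃ i, i ∉ ({w ∈ W | G.Adj v w} : Finset V).image c := by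
        by_contra! hall
        have h1 : (univ : Finset (Fin k)) ⊆ ({w ∈ W | G.Adj v w} : Finset V).image c :=
          fun i _ => hall i
        have h2 := (card_le_card h1).trans card_image_le
        rw [card_univ, Fintype.card_fin] at h2
        omega
      have hi' : ∀ w ∈ W, G.Adj v w → c w ≠ i := by
        intro w hw e hwi
        exact hi (mem_image.2 ⟨w, by simp [hw, e], hwi⟩)
      refine ⟨Function.update c v i, fun x hx y hy e => ?_⟩
      by_cases hxv : x = v
      · subst hxv
        rw [Function.update_self, Function.update_of_ne e.ne']
        exact (hi' y hy e).symm
      · by_cases hyv : y = v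
        · subst hyv
          rw [Function.update_self, Function.update_of_ne hxv]
          exact hi' x hx e.symm
        · rw [Function.update_of_ne hxv, Function.update_of_ne hyv]
          exact hc x (by simp [hx, hxv]) y (by simp [hy, hyv]) e
  obtain ⟨c, hc⟩ := main univ
  exact ⟨SimpleGraph.Coloring.mk c fun e => hc _ (mem_univ _) _ (mem_univ _) e⟩

end Colouring

/-! ### Finite tracks and the refinement of a colouring -/

namespace SimpleGraph

variable {V : Type u} {G : SimpleGraph V}

/-- In a finite track, `v` reaches every later vertex along successors. -/
theorem TrackAssignment.transGen_succ_of_lt [Finite V] {t : ℕ} (T : G.TrackAssignment t) {v w : V}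
    (h : T.lt v w) : Relation.TransGen T.Succ v w := by
  induction hn : {x | T.lt v x ∧ T.lt x w}.ncard using Nat.strong_induction_on
    generalizing v w with
  | _ n ih =>
    by_cases hs : T.Succ v w
    · exact .single hs
    obtain ⟨x, hvx, hxw⟩ : ∃ x, T.lt v x ∧ T.lt x w := by
      by_contra! hne
      exact hs ⟨h, fun x hx => hne x hx.1 hx.2⟩
    have h1 : {y | T.lt v y ∧ T.lt y x}.ncard < n := by
      rw [← hn]
      refine Set.ncard_lt_ncard ((Set.ssubset_iff_of_subset ?_).2 ⟨x, ⟨hvx, hxw⟩, ?_⟩)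
        (Set.toFinite _)
      · exact fun y hy => ⟨hy.1, T.lt_trans _ _ _ hy.2 hxw⟩
      · exact fun hx => T.lt_irrefl x hx.2
    have h2 : {y | T.lt x y ∧ T.lt y w}.ncard < n := by
      rw [← hn]
      refine Set.ncard_lt_ncard ((Set.ssubset_iff_of_subset ?_).2 ⟨x, ⟨hvx, hxw⟩, ?_⟩)
        (Set.toFinite _)
      · exact fun y hy => ⟨T.lt_trans _ _ _ hvx hy.1, hy.2⟩
      · exact fun hx => T.lt_irrefl x hx.1
    exact (ih _ h1 hvx rfl).trans (ih _ h2 hxw rfl)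

/-- Type of labels refining a `t`-colouring: a colour together with a label in `Fin 4` for each
other colour and each pair of distinct elements of `K`. -/
abbrev RefinedTrack (t : ℕ) (K : Type) : Type :=
  Σ i : Fin t, ({j : Fin t // j ≠ i} × {s : Sym2 K // ¬ s.IsDiag}) → Fin 4

theorem card_refinedTrack (t : ℕ) (K : Type) [Fintype K] [DecidableEq K] :
    Fintype.card (RefinedTrack t K) = t * 4 ^ ((t - 1) * (Fintype.card K).choose 2) := by
  have h (i : Fin t) : Fintype.card {j : Fin t // j ≠ i} = t - 1 := by
    rw [Fintype.card_subtype_compl, Fintype.card_fin, Fintype.card_unique]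
  rw [Fintype.card_sigma]
  simp only [Fintype.card_fun, Fintype.card_prod, h, Sym2.card_subtype_not_diag, Fintype.card_fin,
    Finset.sum_const, Finset.card_univ, smul_eq_mul]

/-- A proper `t`-colouring of a linearly ordered graph with a nesting-free `q`-colouring of the
edges can be refined so that the order on the refined colour classes has no X-crossing. -/
theorem exists_refinement [LinearOrder V] [Finite V] {q t : ℕ} (col : Sym2 V → Fin q)
    (hcol : ∀ v w x y, G.Adj v w → G.Adj x y → col s(v, w) = col s(x, y) →
      ¬ (v < x ∧ x < y ∧ y < w)) (c : G.Coloring (Fin t)) :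
    ∃ τ : V → RefinedTrack t (Fin q × Bool), (∀ v, (τ v).1 = c v) ∧
      ∀ v w x y, G.Adj v w → G.Adj x y → τ v = τ x → τ w = τ y → v < x → ¬ y < w := by
  -- The Boolean records whether the edge goes forward from class `i` to class `j`; with equal
  -- direction, a crossing of two edges is a nesting.
  let E : Fin t → Fin t → Fin q × Bool → V → V → Prop := fun i j k a b =>
    c a = i ∧ c b = j ∧ G.Adj a b ∧ (col s(a, b), decide (a < b)) = k
  have hE : ∀ i j k, Noncrossing (E i j k) := by
    rintro i j k a b a' b' ⟨-, -, e, hk⟩ ⟨-, -, e', hk'⟩ haa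
    by_contra! hbb
    have hkk := hk.trans hk'.symm
    simp only [Prod.mk.injEq, decide_eq_decide] at hkk
    rcases lt_or_gt_of_ne e.ne with h | h
    · exact hcol a b a' b' e e' hkk.1 ⟨haa, hkk.2.1 h, hbb⟩
    · have h' : b' < a' := by
        rcases lt_or_gt_of_ne e'.ne with h' | h'
        · exact absurd (hkk.2.2 h') h.asymm
        · exact h'
      refine hcol b' a' b a e'.symm e.symm ?_ ⟨hbb, h, haa⟩
      rw [Sym2.eq_swap, ← hkk.1, Sym2.eq_swap]
  choose α β hαβ using fun i j s => exists_labels_of_colours (E i j) (hE i j) s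
  let τ : V → RefinedTrack t (Fin q × Bool) := fun v =>
    ⟨c v, fun p => if c v < p.1.1 then α (c v) p.1.1 p.2.1 v else β p.1.1 (c v) p.2.1 v⟩
  have hτ : ∀ v x, τ v = τ x → c v = c x ∧ ∀ j ≠ c v, ∀ s : Sym2 (Fin q × Bool), ¬ s.IsDiag →
      (c v < j → α (c v) j s v = α (c v) j s x) ∧ (j < c v → β j (c v) s v = β j (c v) s x) := by
    intro v x h
    have h1 : c v = c x := congrArg Sigma.fst h
    refine ⟨h1, fun j hj s hs => ?_⟩
    have h2 : ∀ (i : Fin t) (hij : j ≠ i) (z z' : RefinedTrack t (Fin q × Bool)) (hz : z.1 = i)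
        (hz' : z'.1 = i), z = z' → z.2 (⟨j, hz ▸ hij⟩, ⟨s, hs⟩) = z'.2 (⟨j, hz' ▸ hij⟩, ⟨s, hs⟩) := by
      rintro i hij z z' hz hz' rfl
      rfl
    have h3 := h2 (c v) hj (τ v) (τ x) rfl h1.symm h
    simp only [τ, ← h1] at h3
    refine ⟨fun hlt => by simpa only [if_pos hlt] using h3,
      fun hlt => by simpa only [if_neg hlt.asymm] using h3⟩
  refine ⟨τ, fun v => rfl, ?_⟩
  have main : ∀ v w x y, G.Adj v w → G.Adj x y → τ v = τ x → τ w = τ y → v < x → y < w →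
      ¬ c v < c w := by
    intro v w x y e f hvx hwy h1 h2 hlt
    obtain ⟨hc1, hl1⟩ := hτ v x hvx
    obtain ⟨hc2, hl2⟩ := hτ w y hwy
    set s := s((col s(v, w), decide (v < w)), (col s(x, y), decide (x < y))) with hs
    have he : E (c v) (c w) (col s(v, w), decide (v < w)) v w := ⟨rfl, rfl, e, rfl⟩
    have hf : E (c v) (c w) (col s(x, y), decide (x < y)) x y := ⟨hc1.symm, hc2.symm, f, rfl⟩
    -- Edges of one relation do not cross, so diagonal pairs need no label.
    by_cases hd : s.IsDiag
    · rw [hs, Sym2.mk_isDiag_iff] at hd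
      rw [← hd] at hf
      exact absurd (hE _ _ _ _ _ _ _ he hf h1) h2.not_ge
    · exact hαβ (c v) (c w) s _ _ _ _ _ _ hs.symm he hf h1 h2
        ((hl1 _ hlt.ne' s hd).1 hlt) ((hl2 _ hlt.ne s hd).2 hlt)
  intro v w x y e f hvx hwy h1 h2
  rcases lt_or_gt_of_ne (c.valid e) with h | h
  · exact main v w x y e f hvx hwy h1 h2 h
  · refine main y x w v f.symm e.symm hwy.symm hvx.symm h2 h1 ?_
    rwa [← (hτ _ _ hvx).1, ← (hτ _ _ hwy).1]

end SimpleGraph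

/-! ### The two conversions and the numerical bounds -/

namespace Digraph

variable {V : Type u} (D : Digraph V)

theorem HasUpwardQueueLayout.mono {D : Digraph V} {k l : ℕ} (h : D.HasUpwardQueueLayout k)
    (hkl : k ≤ l) : D.HasUpwardQueueLayout l := by
  obtain ⟨σ, E, hσ, hE⟩ := h
  refine ⟨σ, fun e => Fin.castLE hkl (E e), hσ, fun v w x y e f h => hE v w x y e f ?_⟩
  exact Fin.castLE_injective hkl h

/-- A vertex ordering that makes every track increasing and every arc forward shows that the
track assignment is upward. -/
theorem plus_isAcyclic_of_lt {t : ℕ} (T : D.toSimpleGraphInclusive.TrackAssignment t)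
    {ι : Type*} [Preorder ι] (σ : V → ι) (h1 : ∀ v w, D.Adj v w → σ v < σ w)
    (h2 : ∀ v w, T.lt v w → σ v < σ w) : (D.plus T).IsAcyclic := by
  intro v h
  have : ∀ w, Relation.TransGen (D.plus T).Adj v w → σ v < σ w := by
    intro w hw
    induction hw with
    | single h => exact h.elim (h1 _ _) fun h => h2 _ _ h.1
    | tail _ h ih => exact ih.trans (h.elim (h1 _ _) fun h => h2 _ _ h.1)
  exact lt_irrefl _ (this v h)

theorem HasUpwardColouredTrackLayout.hasUpwardQueueLayout [Finite V] {D : Digraph V} {k t : ℕ}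
    (h : D.HasUpwardColouredTrackLayout k t) : D.HasUpwardQueueLayout (k * t.choose 2) := by
  obtain ⟨T, ⟨c, hc⟩, hT⟩ := h
  obtain ⟨σ, hσ⟩ := (D.plus T).exists_topological hT
  have hlt : ∀ v w, T.lt v w → σ v < σ w := by
    intro v w h
    have h' := T.transGen_succ_of_lt h
    clear h
    induction h' with
    | single h => exact hσ _ _ (Or.inr h)
    | tail _ h ih => exact ih.trans (hσ _ _ (Or.inr h))
  have hle : ∀ v w, T.track v = T.track w → σ v < σ w → T.lt v w := by
    intro v w h h'
    rcases T.lt_total v w h (by rintro rfl; exact lt_irrefl _ h') with h1 | h1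
    · exact h1
    · exact absurd (hlt _ _ h1) h'.asymm
  have hcard : Fintype.card (Fin k × {s : Sym2 (Fin t) // ¬ s.IsDiag}) = k * t.choose 2 := by
    rw [Fintype.card_prod, Sym2.card_subtype_not_diag, Fintype.card_fin, Fintype.card_fin]
  let pair : D.toSimpleGraphInclusive.edgeSet → {s : Sym2 (Fin t) // ¬ s.IsDiag} := fun e =>
    ⟨e.1.map T.track, by
      obtain ⟨e, he⟩ := e
      induction e with
      | _ v w => simpa using T.track.valid he⟩
  refine ⟨σ, fun e => Fintype.equivFinOfCardEq hcard (c e, pair e),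
    fun v w h => hσ v w (Or.inl h), ?_⟩
  rintro v w x y e f h ⟨h1, h2, h3⟩
  have h := (Fintype.equivFinOfCardEq hcard).injective h
  simp only [Prod.mk.injEq, pair, Subtype.mk.injEq, Sym2.map_mk, Sym2.eq_iff] at h
  -- The inner edge may run between the two tracks in either direction; in both cases the nesting
  -- gives an X-crossing, in the second after reversing `xy`.
  obtain ⟨hcol, ⟨ha, hb⟩ | ⟨ha, hb⟩⟩ := h
  · exact hc v w x y e f hcol ⟨T.track.valid e, hle _ _ ha h1, hle _ _ hb.symm h3⟩
  · refine hc v w y x e f.symm ?_ ⟨T.track.valid e, hle _ _ ha (h1.trans h2),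
      hle _ _ hb.symm (h2.trans h3)⟩
    rw [hcol]
    congr 2
    exact Sym2.eq_swap

theorem HasUpwardQueueLayout.hasUpwardTrackLayout [Finite V] {D : Digraph V} {q : ℕ} (hq : 1 ≤ q)
    (h : D.HasUpwardQueueLayout q) :
    D.HasUpwardTrackLayout (4 * q * 4 ^ ((4 * q - 1) * (2 * q).choose 2)) := by
  classical
  obtain ⟨σ, E, hσ, hE⟩ := h
  let _ : LinearOrder V := LinearOrder.lift' σ σ.injective
  let col : Sym2 V → Fin q := fun e =>
    if h : e ∈ D.toSimpleGraphInclusive.edgeSet then E ⟨e, h⟩ else ⟨0, hq⟩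
  have hcol : ∀ v w x y, D.toSimpleGraphInclusive.Adj v w → D.toSimpleGraphInclusive.Adj x y →
      col s(v, w) = col s(x, y) → ¬ (v < x ∧ x < y ∧ y < w) := by
    intro v w x y e f h
    have e' : s(v, w) ∈ D.toSimpleGraphInclusive.edgeSet := e
    have f' : s(x, y) ∈ D.toSimpleGraphInclusive.edgeSet := f
    simp only [col, dif_pos e', dif_pos f'] at h
    exact hE v w x y e f h
  obtain ⟨c⟩ := colorable_of_exists_degree_lt D.toSimpleGraphInclusive (k := 4 * q) (by omega)
    fun W hW => exists_degree_lt_of_queue _ hq col hcol W hW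
  obtain ⟨τ, hτ, hX⟩ := SimpleGraph.exists_refinement col hcol c
  have hcard : Fintype.card (SimpleGraph.RefinedTrack (4 * q) (Fin q × Bool)) =
      4 * q * 4 ^ ((4 * q - 1) * (2 * q).choose 2) := by
    rw [SimpleGraph.card_refinedTrack, Fintype.card_prod, Fintype.card_fin, Fintype.card_bool,
      mul_comm q 2]
  let ε := Fintype.equivFinOfCardEq hcard
  let T : D.toSimpleGraphInclusive.TrackAssignment
      (4 * q * 4 ^ ((4 * q - 1) * (2 * q).choose 2)) :=
    { track := SimpleGraph.Coloring.mk (fun v => ε (τ v)) fun {v w} e h => c.valid e (by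
        rw [← hτ v, ← hτ w, ε.injective h])
      lt := fun v w => ε (τ v) = ε (τ w) ∧ v < w
      lt_same := fun v w h => h.1
      lt_irrefl := fun v h => lt_irrefl v h.2
      lt_trans := fun u v w h h' => ⟨h.1.trans h'.1, h.2.trans h'.2⟩
      lt_total := fun v w h hne => (lt_or_gt_of_ne hne).imp (fun h' => ⟨h, h'⟩)
        fun h' => ⟨h.symm, h'⟩ }
  refine ⟨T, ?_, D.plus_isAcyclic_of_lt T σ hσ fun v w h => h.2⟩
  rintro v w x y e f ⟨-, h1, h2⟩
  exact hX v w x y e f (ε.injective h1.1) (ε.injective h2.1).symm h1.2 h2.2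

theorem upwardQueueNumber_le [Finite V] {D : Digraph V} (hD : D.IsAcyclic) {k : ℕ} (hk : 1 ≤ k) :
    D.upwardQueueNumber ≤ k * (D.upwardColouredTrackNumber k).choose 2 := by
  obtain ⟨t, ht⟩ := D.exists_upwardTrackLayout hD
  have h : D.HasUpwardColouredTrackLayout k (D.upwardColouredTrackNumber k) :=
    Nat.sInf_mem (s := {t | D.HasUpwardColouredTrackLayout k t}) ⟨t, ht.coloured hk⟩
  exact Nat.sInf_le h.hasUpwardQueueLayout

theorem upwardTrackNumber_le [Finite V] {D : Digraph V} (hD : D.IsAcyclic) {q : ℕ} (hq : 1 ≤ q)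
    (h : D.upwardQueueNumber ≤ q) :
    D.upwardTrackNumber ≤ 4 * q * 4 ^ (q * (2 * q - 1) * (4 * q - 1)) := by
  have h' : D.HasUpwardQueueLayout D.upwardQueueNumber :=
    Nat.sInf_mem (s := {k | D.HasUpwardQueueLayout k}) (D.exists_upwardQueueLayout hD)
  have hle : D.upwardTrackNumber ≤ 4 * q * 4 ^ ((4 * q - 1) * (2 * q).choose 2) :=
    Nat.sInf_le ((h'.mono h).hasUpwardTrackLayout hq)
  have hchoose : (2 * q).choose 2 = q * (2 * q - 1) := by
    rw [Nat.choose_two_right, mul_assoc, Nat.mul_div_cancel_left _ (by norm_num)]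
  rwa [hchoose, mul_comm (4 * q - 1)] at hle

theorem upwardColouredTrackNumber_one_le [Finite V] {D : Digraph V} (hD : D.IsAcyclic) :
    D.upwardColouredTrackNumber 1 ≤ D.upwardTrackNumber := by
  have h : D.HasUpwardTrackLayout D.upwardTrackNumber :=
    Nat.sInf_mem (s := {t | D.HasUpwardTrackLayout t}) (D.exists_upwardTrackLayout hD)
  exact Nat.sInf_le (h.coloured le_rfl)

end Digraph

theorem mainTheorem6 :
    (∃ f : ℕ → ℕ, ∀ (V : Type u) [Finite V] (D : Digraph V), D.IsAcyclic →
      D.upwardTrackNumber ≤ f D.upwardQueueNumber ∧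
      D.upwardQueueNumber ≤ f D.upwardTrackNumber) ∧
    (∀ (V : Type u) [Finite V] (D : Digraph V), D.IsAcyclic → ∀ k : ℕ, 1 ≤ k →
      D.upwardQueueNumber ≤ k * (D.upwardColouredTrackNumber k).choose 2) ∧
    (∀ (V : Type u) [Finite V] (D : Digraph V), D.IsAcyclic → ∀ q : ℕ, 1 ≤ q →
      D.upwardQueueNumber ≤ q →
      D.upwardTrackNumber ≤ 4 * q * 4 ^ (q * (2 * q - 1) * (4 * q - 1))) := by
  -- The queue bound needs `q ≥ 1`, hence `n + 1`, as the queue-number may be 0. Adding the two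
  -- bounds dominates both.
  refine ⟨⟨fun n => 4 * (n + 1) * 4 ^ ((n + 1) * (2 * (n + 1) - 1) * (4 * (n + 1) - 1)) +
    n.choose 2, fun V _ D hD => ⟨?_, ?_⟩⟩, fun V _ D hD k hk => Digraph.upwardQueueNumber_le hD hk,
    fun V _ D hD q hq h => Digraph.upwardTrackNumber_le hD hq h⟩
  · exact (Digraph.upwardTrackNumber_le hD (by omega) (Nat.le_succ _)).trans (Nat.le_add_right _ _)
  · have h := Digraph.upwardQueueNumber_le hD le_rfl
    rw [one_mul] at h
    exact (h.trans (Nat.choose_le_choose 2 (Digraph.upwardColouredTrackNumber_one_le hD))).trans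
      (Nat.le_add_left _ _)
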